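/- Let $r,s,t$ be integers with $1\le r\le s\le t$ and put $n=r+s+t+1$. The exchanged 3-ary $n$-cube $E3C(r,s,t)$ is the simple graph whose vertices are the strings $ABCd$ with $A\in\{0,1,2\}^r$, $B\in\{0,1,2\}^s$, $C\in\{0,1,2\}^t$ and $d\in\{0,1,2\}$, in which two vertices $ABCd$ and $A'B'C'd'$ are adjacent if and only if one of the following holds: (0) $A=A'$, $B=B'$, $C=C'$ and $d\ne d'$; (1) $d=d'=0$, $A=A'$, $B=B'$, and $C,C'$ differ in exactly one position; (2) $d=d'=1$, $A=A'$, $C=C'$, and $B,B'$ differ in exactly one position; (3) $d=d'=2$, $B=B'$, $C=C'$, and $A,A'$ differ in exactly one position. For a graph $G$, the $k$-wide diameter $D_k(G)$ is the maximum, over all pairs of distinct vertices $u,v$, of the minimum, over all systems of $k$ distinct pairwise internally disjoint paths from $u$ to $v$, of the length of a longest path in the system. Then $$D_{2r+2}(E3C(r,s,t))\le r+s+t+6=n+5.$$ In particular, between any two distinct vertices of $E3C(r,s,t)$ there are $2r+2$ pairwise internally disjoint paths, each of length at most $n+5$. -/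

import Mathlib

/-- Two paths from `u` to `v` are internally disjoint: they share no vertex besides `u`, `v`. -/
def InternallyDisjoint {V : Type*} {G : SimpleGraph V} {u v : V} (p q : G.Path u v) : Prop :=
  ∀ w : V, w ∈ p.1.support → w ∈ q.1.support → w = u ∨ w = v

/-- A system of `k` (pairwise distinct) pairwise internally disjoint paths from `u` to `v`.
Injectivity matters only for adjacent `u`, `v`: the edge `uv` may not be used twice. -/
structure IsDisjointPathSystem {V : Type*} {G : SimpleGraph V} {u v : V} {k : ℕ}
    (P : Fin k → G.Path u v) : Prop where
  injective : Function.Injective P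
  disjoint : ∀ i j : Fin k, i ≠ j → InternallyDisjoint (P i) (P j)

/-- The minimum, over all systems of `k` internally disjoint paths from `u` to `v`, of the length
of a longest path of the system. It is `⊤` if there is no such system. -/
noncomputable def wideDistance {V : Type*} (G : SimpleGraph V) (k : ℕ) (u v : V) : ℕ∞ :=
  ⨅ (P : Fin k → G.Path u v) (_ : IsDisjointPathSystem P),
    ⨆ i : Fin k, ((P i).1.length : ℕ∞)

/-- The `k`-wide diameter of `G`: the maximum of the `k`-wide distances of distinct vertices. -/
noncomputable def wideDiameter {V : Type*} (G : SimpleGraph V) (k : ℕ) : ℕ∞ :=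
  ⨆ (u : V) (v : V) (_ : u ≠ v), wideDistance G k u v

/-- A ternary string `ABCd` of length `r + s + t + 1`, where `A`, `B`, `C` are its blocks of
lengths `r`, `s`, `t` and `d` is its last digit. -/
@[ext] structure E3CVertex (r s t : ℕ) where
  a : Fin r → Fin 3
  b : Fin s → Fin 3
  c : Fin t → Fin 3
  d : Fin 3

/-- Adjacency in the exchanged 3-ary cube: either only the last digits differ, or the last digits
agree and the strings differ in exactly one other position, which lies in the block `C`, `B` or `A`
according to whether the last digit is `0`, `1` or `2`. -/
def E3CAdj {r s t : ℕ} (x y : E3CVertex r s t) : Prop :=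
  (x.a = y.a ∧ x.b = y.b ∧ x.c = y.c ∧ x.d ≠ y.d) ∨
  (x.a = y.a ∧ x.b = y.b ∧ hammingDist x.c y.c = 1 ∧ x.d = 0 ∧ y.d = 0) ∨
  (x.a = y.a ∧ hammingDist x.b y.b = 1 ∧ x.c = y.c ∧ x.d = 1 ∧ y.d = 1) ∨
  (hammingDist x.a y.a = 1 ∧ x.b = y.b ∧ x.c = y.c ∧ x.d = 2 ∧ y.d = 2)

/-- The exchanged 3-ary `n`-cube `E3C(r, s, t)`, `n = r + s + t + 1`. -/
def E3C (r s t : ℕ) : SimpleGraph (E3CVertex r s t) where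
  Adj := E3CAdj
  symm := by
    constructor
    rintro x y (⟨h1, h2, h3, h4⟩ | ⟨h1, h2, h3, h4, h5⟩ | ⟨h1, h2, h3, h4, h5⟩ |
      ⟨h1, h2, h3, h4, h5⟩)
    · exact Or.inl ⟨h1.symm, h2.symm, h3.symm, h4.symm⟩
    · exact Or.inr (Or.inl ⟨h1.symm, h2.symm, hammingDist_comm x.c y.c ▸ h3, h5, h4⟩)
    · exact Or.inr (Or.inr (Or.inl ⟨h1.symm, hammingDist_comm x.b y.b ▸ h2, h3.symm, h5, h4⟩))
    · exact Or.inr (Or.inr (Or.inr ⟨hammingDist_comm x.a y.a ▸ h1, h2.symm, h3.symm, h5, h4⟩))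
  loopless := by
    constructor
    rintro x (⟨_, _, _, h⟩ | ⟨_, _, h, _⟩ | ⟨_, h, _⟩ | ⟨h, _⟩)
    · exact h rfl
    all_goals simp at h

/-! Disjoint paths are found as regions meeting only in `v`, each reaching `v` from its own
neighbour of `u`; a walk inside a region shortens to a path there. Permuting the blocks together
with the last digits leaves two cases.

Last digits 0 and 0: `2 * m` paths first move `c` to distinct neighbours `g i`, taken from a fan in
the Hamming graph (`ternaryCube.isFan`). If `b ≠ b'`, each keeps `g i` as a label while `b`, and if
necessary `a`, is corrected, and then follows the fan above `(a', b')`. If `a` and `b` are already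
right, the fan stays in one copy; if only `a` is wrong, the blocks A and B are exchanged. Two more
paths leave through the digits 1 and 2, where necessary by way of a string `z` that the others do
not use (`ternaryCube.exists_third`).

Last digits 0 and 1: a path gets two labels, `A i` in the unit ball about `c` and `B i` in that
about `b'`, and changes `c` to `A i`, `b` to `B i`, `a` to `a'`, `A i` to `c'`, `B i` to `b'`
(`E3C.isFan_pairs`). One more path leaves through digit 2 and uses digit 2 only above `(b, c)` and
`(b', c')`; the labels avoid these pairs by `ternaryCube.exists_pairing`. If `a = a'`, the labels
`c'` and `b` are harmful too, and a direct path along geodesics replaces one labelled path. -/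

/-! ### Walks confined to regions, and fans. -/

/-- There is a walk from `p` to `q` of length at most `n` all of whose vertices lie in `S`. -/
def ReachIn {V : Type*} (G : SimpleGraph V) (S : Set V) (n : ℕ) (p q : V) : Prop :=
  ∃ w : G.Walk p q, w.length ≤ n ∧ ∀ x ∈ w.support, x ∈ S

namespace ReachIn

variable {V W : Type*} {G : SimpleGraph V} {H : SimpleGraph W} {S T : Set V} {m n : ℕ} {p q x : V}

theorem refl (h : p ∈ S) : ReachIn G S 0 p p := ⟨.nil, by simp, by simpa⟩

theorem of_adj (h : G.Adj p q) (hp : p ∈ S) (hq : q ∈ S) : ReachIn G S 1 p q :=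
  ⟨h.toWalk, by simp, by simp [hp, hq]⟩

theorem trans (h₁ : ReachIn G S m p q) (h₂ : ReachIn G S n q x) : ReachIn G S (m + n) p x := by
  obtain ⟨w₁, l₁, s₁⟩ := h₁
  obtain ⟨w₂, l₂, s₂⟩ := h₂
  refine ⟨w₁.append w₂, by rw [SimpleGraph.Walk.length_append]; omega, fun y hy => ?_⟩
  rw [SimpleGraph.Walk.mem_support_append_iff] at hy
  exact hy.elim (s₁ y) (s₂ y)

theorem mono (h : ReachIn G S m p q) (hST : S ⊆ T) (hmn : m ≤ n) : ReachIn G T n p q := by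
  obtain ⟨w, l, s⟩ := h
  exact ⟨w, l.trans hmn, fun y hy => hST (s y hy)⟩

theorem mono_length (h : ReachIn G S m p q) (hmn : m ≤ n) : ReachIn G S n p q :=
  h.mono subset_rfl hmn

theorem map (h : ReachIn G S n p q) (f : G →g H) {T : Set W} (hf : ∀ y ∈ S, f y ∈ T) :
    ReachIn H T n (f p) (f q) := by
  obtain ⟨w, l, s⟩ := h
  refine ⟨w.map f, by simpa, fun y hy => ?_⟩
  rw [SimpleGraph.Walk.support_map, List.mem_map] at hy
  obtain ⟨z, hz, rfl⟩ := hy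
  exact hf z (s z hz)

theorem symm (h : ReachIn G S n p q) : ReachIn G S n q p := by
  obtain ⟨w, l, s⟩ := h
  exact ⟨w.reverse, by simpa, by simpa using s⟩

end ReachIn

/-- A family of regions `T i` that share at most the vertex `v`, avoid `u` unless `u = v`, and in
which `v` can be reached within `n` steps from pairwise distinct neighbours `f i` of `u`. -/
structure IsFan {V ι : Type*} (G : SimpleGraph V) (n : ℕ) (u v : V) (T : ι → Set V)
    (f : ι → V) : Prop where
  injective : Function.Injective f
  adj : ∀ i, G.Adj u (f i)
  start : ∀ i, u ∈ T i → u = v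
  disjoint : ∀ i j, i ≠ j → ∀ w, w ∈ T i → w ∈ T j → w = v
  reach : ∀ i, ReachIn G (T i) n (f i) v

namespace IsFan

variable {V W ι κ : Type*} {G : SimpleGraph V} {n : ℕ} {u v : V} {T : ι → Set V} {f : ι → V}

theorem mem (h : IsFan G n u v T f) (i : ι) : f i ∈ T i := by
  obtain ⟨w, -, hw⟩ := h.reach i
  exact hw _ w.start_mem_support

theorem comp (h : IsFan G n u v T f) {g : κ → ι} (hg : Function.Injective g) :
    IsFan G n u v (T ∘ g) (f ∘ g) where
  injective := h.injective.comp hg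
  adj _ := h.adj _
  start _ := h.start _
  disjoint _ _ hij := h.disjoint _ _ (hg.ne hij)
  reach _ := h.reach _

theorem option (h : IsFan G n u v T f) {S : Set V} {p : V} (hp : ∀ i, p ≠ f i) (hadj : G.Adj u p)
    (hu : u ∈ S → u = v) (hd : ∀ i, ∀ w ∈ S, w ∈ T i → w = v) (hr : ReachIn G S n p v) :
    IsFan G n u v (fun o : Option ι => o.elim S T) (fun o => o.elim p f) where
  injective := by
    rintro (_ | i) (_ | j) hij
    · rfl
    · exact (hp j hij).elim
    · exact (hp i hij.symm).elim
    · exact congrArg some (h.injective hij)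
  adj := by rintro (_ | i); exacts [hadj, h.adj i]
  start := by rintro (_ | i); exacts [hu, h.start i]
  disjoint := by
    rintro (_ | i) (_ | j) hij w hi hj
    · exact (hij rfl).elim
    · exact hd j w hi hj
    · exact hd i w hj hi
    · exact h.disjoint i j (fun e => hij (congrArg some e)) w hi hj
  reach := by rintro (_ | i); exacts [hr, h.reach i]

theorem map_iso {H : SimpleGraph W} (h : IsFan G n u v T f) (e : G ≃g H) :
    IsFan H n (e u) (e v) (fun i => e.symm ⁻¹' T i) (e ∘ f) where
  injective := e.injective.comp h.injective
  adj _ := e.map_adj_iff.2 (h.adj _)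
  start _ hi := by
    rw [Set.mem_preimage, e.symm_apply_apply] at hi
    rw [h.start _ hi]
  disjoint _ _ hij _ hi hj := by
    rw [← h.disjoint _ _ hij _ hi hj, e.apply_symm_apply]
  reach i := (h.reach i).map e.toHom fun y hy => by
    change e.symm (e y) ∈ T i
    rwa [e.symm_apply_apply]

/-- A fan gives a system of internally disjoint paths. -/
theorem exists_pathSystem [Fintype ι] {k : ℕ} (h : IsFan G n u v T f) (huv : u ≠ v)
    (hk : Fintype.card ι = k) :
    ∃ P : Fin k → G.Path u v, IsDisjointPathSystem P ∧ ∀ i, (P i).1.length ≤ n + 1 := by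
  classical
  have key : ∀ i, ∃ p : G.Path u v, p.1.snd = f i ∧ p.1.length ≤ n + 1 ∧
      ∀ w ∈ p.1.support, w = u ∨ w ∈ T i := by
    intro i
    obtain ⟨w, hl, hs⟩ := h.reach i
    have hsub : ∀ y ∈ w.bypass.support, y ∈ T i := fun y hy =>
      hs y (w.support_bypass_subset_support hy)
    refine ⟨⟨.cons (h.adj i) w.bypass, ?_⟩, ?_, ?_, ?_⟩
    · rw [SimpleGraph.Walk.cons_isPath_iff]
      exact ⟨w.bypass_isPath, fun hu => huv (h.start i (hsub u hu))⟩
    · simp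
    · have := w.length_bypass_le_length
      simp only [SimpleGraph.Walk.length_cons]
      omega
    · intro y hy
      rw [SimpleGraph.Walk.support_cons, List.mem_cons] at hy
      exact hy.imp_right (hsub y)
  choose p hsnd hlen hsupp using key
  let e : Fin k ≃ ι := (Fintype.equivFinOfCardEq hk).symm
  refine ⟨p ∘ e, ⟨?_, ?_⟩, fun i => hlen _⟩
  -- Distinct second vertices separate the paths even if `u` and `v` are adjacent, when disjointness
  -- alone would not.
  · intro i j hij
    apply e.injective
    apply h.injective
    rw [← hsnd, ← hsnd]
    exact congrArg (fun q : G.Path u v => q.1.snd) hij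
  · intro i j hij w hi hj
    rcases hsupp _ w hi with hw | hw
    · exact .inl hw
    rcases hsupp _ w hj with hw' | hw'
    · exact .inl hw'
    exact .inr (h.disjoint _ _ (e.injective.ne hij) w hw hw')

end IsFan

/-! ### A fan of `2 * l` paths in the Hamming graph. -/

/-- The Hamming graph on ternary strings of length `l`. -/
def ternaryCube (l : ℕ) : SimpleGraph (Fin l → Fin 3) where
  Adj x y := hammingDist x y = 1
  symm := ⟨fun x y h => by rwa [hammingDist_comm]⟩
  loopless := ⟨fun x h => by simp at h⟩

namespace ternaryCube

variable {l : ℕ}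

theorem adj_iff {x y : Fin l → Fin 3} : (ternaryCube l).Adj x y ↔ hammingDist x y = 1 := Iff.rfl

theorem hammingDist_le (x y : Fin l → Fin 3) : hammingDist x y ≤ l := by
  simpa using hammingDist_le_card_fintype (x := x) (y := y)

theorem hammingDist_update_self (x : Fin l → Fin 3) (k : Fin l) {q : Fin 3} (h : q ≠ x k) :
    hammingDist x (Function.update x k q) = 1 := by
  rw [hammingDist, Finset.card_eq_one]
  refine ⟨k, ?_⟩
  ext i
  by_cases hi : i = k
  · subst hi; simp [h.symm]
  · simp [hi]

theorem exists_update_of_hammingDist_eq_one {x y : Fin l → Fin 3} (h : hammingDist x y = 1) :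
    ∃ k, y k ≠ x k ∧ y = Function.update x k (y k) := by
  rw [hammingDist, Finset.card_eq_one] at h
  obtain ⟨k, hk⟩ := h
  have h' : ∀ i, x i ≠ y i ↔ i = k := fun i => by
    have := congrArg (i ∈ ·) hk
    simpa using this
  refine ⟨k, ((h' k).2 rfl).symm, ?_⟩
  funext i
  by_cases hi : i = k
  · subst hi; simp
  · rw [Function.update_of_ne hi]
    by_contra hne
    exact hi ((h' i).1 (Ne.symm hne))

theorem hammingDist_update_add_one {x y : Fin l → Fin 3} {k : Fin l} (h : x k ≠ y k) :
    hammingDist (Function.update x k (y k)) y + 1 = hammingDist x y := by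
  have : (Finset.univ.filter fun i => x i ≠ y i) =
      insert k (Finset.univ.filter fun i => Function.update x k (y k) i ≠ y i) := by
    ext i
    by_cases hi : i = k
    · subst hi; simp [h]
    · simp [hi]
  rw [hammingDist, hammingDist, this, Finset.card_insert_of_notMem (by simp)]

/-- A geodesic between two strings; each of its vertices agrees with one of its ends at every
position. -/
theorem reachIn_box (x y : Fin l → Fin 3) :
    ReachIn (ternaryCube l) {w | (∀ i, w i = x i ∨ w i = y i) ∧
      hammingDist x w + hammingDist w y ≤ hammingDist x y} (hammingDist x y) x y := by
  induction h : hammingDist x y generalizing x with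
  | zero =>
    obtain rfl := hammingDist_eq_zero.1 h
    exact .refl (by simp)
  | succ n ih =>
    have hne : x ≠ y := by rintro rfl; simp at h
    obtain ⟨k, hk⟩ := Function.ne_iff.1 hne
    have h1 := hammingDist_update_add_one hk
    have hd := hammingDist_update_self x k hk.symm
    have h2 := ih (Function.update x k (y k)) (by omega)
    have h3 : ReachIn (ternaryCube l) {w | (∀ i, w i = x i ∨ w i = y i) ∧
        hammingDist x w + hammingDist w y ≤ n + 1} 1 x (Function.update x k (y k)) := by
      refine .of_adj hd ⟨fun i => .inl rfl, by simp [h]⟩ ⟨fun i => ?_, by omega⟩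
      by_cases hi : i = k
      · subst hi; simp
      · simp [hi]
    rw [add_comm n 1]
    rw [add_comm n 1] at h3
    refine h3.trans (h2.mono ?_ le_rfl)
    rintro w ⟨hw, hw'⟩
    refine ⟨fun i => ?_, ?_⟩
    · by_cases hi : i = k
      · subst hi; exact .inr (by simpa using hw i)
      · simpa [hi] using hw i
    · have := hammingDist_triangle x (Function.update x k (y k)) w
      omega

theorem reachIn_univ (x y : Fin l → Fin 3) :
    ReachIn (ternaryCube l) Set.univ (hammingDist x y) x y :=
  (reachIn_box x y).mono (Set.subset_univ _) le_rfl

/-- The neighbour of `x` obtained by increasing the `k`-th digit by one or two. -/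
def neighbor (x : Fin l → Fin 3) (p : Fin l × Bool) : Fin l → Fin 3 :=
  Function.update x p.1 (x p.1 + bif p.2 then 1 else 2)

theorem add_cond_ne (q : Fin 3) (e : Bool) : q + (bif e then 1 else 2) ≠ q := by
  revert q e; decide

theorem adj_neighbor (x : Fin l → Fin 3) (p : Fin l × Bool) :
    (ternaryCube l).Adj x (neighbor x p) :=
  hammingDist_update_self x p.1 (add_cond_ne _ _)

theorem neighbor_apply_self_ne (x : Fin l → Fin 3) (p : Fin l × Bool) :
    neighbor x p p.1 ≠ x p.1 := by
  rw [neighbor, Function.update_self]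
  exact add_cond_ne _ _

theorem neighbor_apply_of_ne (x : Fin l → Fin 3) (p : Fin l × Bool) {i : Fin l} (h : i ≠ p.1) :
    neighbor x p i = x i := by
  simp [neighbor, h]

theorem neighbor_ne (x : Fin l → Fin 3) (p : Fin l × Bool) : neighbor x p ≠ x :=
  fun h => neighbor_apply_self_ne x p (congrFun h p.1)

theorem neighbor_injective (x : Fin l → Fin 3) : Function.Injective (neighbor x) := by
  rintro ⟨k, e⟩ ⟨k', e'⟩ h
  obtain rfl : k = k' := by
    by_contra hk
    exact neighbor_apply_self_ne x (k, e) (by rw [h, neighbor_apply_of_ne x _ hk])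
  have := congrFun h k
  simp only [neighbor, Function.update_self, add_right_inj] at this
  cases e <;> cases e' <;> simp at this ⊢

theorem exists_eq_neighbor {x y : Fin l → Fin 3} (h : hammingDist x y = 1) :
    ∃ p, y = neighbor x p := by
  obtain ⟨k, hk, hy⟩ := exists_update_of_hammingDist_eq_one h
  have : ∀ q q' : Fin 3, q' ≠ q → ∃ e : Bool, q' = q + bif e then 1 else 2 := by decide
  obtain ⟨e, he⟩ := this _ _ hk
  exact ⟨(k, e), by rw [neighbor, ← he]; exact hy⟩

/-- Giving one digit a value that neither string has there costs one step from `x`, and `y` is then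
at most `l` away. A detour through `z` thus exceeds the block length by at most one. -/
theorem exists_third (hl : 1 ≤ l) (x y : Fin l → Fin 3) :
    ∃ z, z ≠ x ∧ z ≠ y ∧ hammingDist x z + hammingDist z y ≤ l + 1 := by
  have key : ∀ k : Fin l, (x = y ∨ x k ≠ y k) →
      ∃ z, z ≠ x ∧ z ≠ y ∧ hammingDist x z + hammingDist z y ≤ l + 1 := by
    intro k hk
    have : ∀ q q' : Fin 3, ∃ e, e ≠ q ∧ e ≠ q' := by decide
    obtain ⟨q, hq, hq'⟩ := this (x k) (y k)
    have h1 := hammingDist_update_self x k hq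
    refine ⟨Function.update x k q, fun h => hq (by rw [← h]; simp),
      fun h => hq' (by rw [← h]; simp), ?_⟩
    have h2 := hammingDist_le (Function.update x k q) y
    omega
  rcases eq_or_ne x y with h | h
  · exact key ⟨0, hl⟩ (.inl h)
  · obtain ⟨k, hk⟩ := Function.ne_iff.1 h
    exact key k (.inr hk)

/-- The cyclic distance from `k` to `i`. -/
def cyclicDist (k i : Fin l) : ℕ := if k ≤ i then (i : ℕ) - k else l + i - k

/-- The string that agrees with `y` at the `j + 1` positions following `k` cyclically, starting
with `k`, and with `x` elsewhere. -/
def cyclicMix (x y : Fin l → Fin 3) (k : Fin l) (j : ℕ) : Fin l → Fin 3 :=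
  fun i => if cyclicDist k i ≤ j then y i else x i

theorem cyclicDist_lt (k i : Fin l) : cyclicDist k i < l := by
  unfold cyclicDist; split_ifs <;> omega

theorem cyclicDist_self (k : Fin l) : cyclicDist k k = 0 := by simp [cyclicDist]

theorem cyclicDist_injective (k : Fin l) : Function.Injective (cyclicDist k) := by
  intro i j h
  unfold cyclicDist at h
  ext
  split_ifs at h with h1 h2 h2 <;> rw [Fin.le_def] at h1 h2 <;> omega

theorem cyclicDist_le_or {k k' : Fin l} (h : k ≠ k') (i : Fin l) :
    cyclicDist k i ≤ cyclicDist k k' ∨ cyclicDist k' i ≤ cyclicDist k' k := by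
  rw [Ne, Fin.ext_iff] at h
  simp only [cyclicDist, Fin.le_def]
  split_ifs <;> omega

theorem cyclicMix_zero (x y : Fin l → Fin 3) (k : Fin l) :
    cyclicMix x y k 0 = Function.update x k (y k) := by
  funext i
  by_cases hi : i = k
  · subst hi; simp [cyclicMix, cyclicDist_self]
  · have : cyclicDist k i ≠ 0 := fun h => hi (cyclicDist_injective k (h.trans (cyclicDist_self k).symm))
    simp [cyclicMix, this, hi]

theorem cyclicMix_of_le (x y : Fin l → Fin 3) (k : Fin l) {j : ℕ} (hj : l ≤ j + 1) :
    cyclicMix x y k j = y := by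
  funext i
  have := cyclicDist_lt k i
  simp [cyclicMix, show cyclicDist k i ≤ j by omega]

theorem reachIn_cyclicMix (x y : Fin l → Fin 3) (k : Fin l) (j : ℕ) :
    ReachIn (ternaryCube l) (Set.range (cyclicMix x y k)) j (Function.update x k (y k))
      (cyclicMix x y k j) := by
  induction j with
  | zero => rw [cyclicMix_zero]; exact .refl ⟨0, cyclicMix_zero x y k⟩
  | succ j ih =>
    refine ih.trans ?_
    -- The string stands still if `x` and `y` agree at the next position or no position is left.
    by_cases h : cyclicMix x y k j = cyclicMix x y k (j + 1)
    · rw [h]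
      exact (ReachIn.refl (Set.mem_range_self _)).mono_length (by omega)
    · refine .of_adj ?_ ⟨_, rfl⟩ ⟨_, rfl⟩
      obtain ⟨i, hi⟩ := Function.ne_iff.1 h
      have hij : cyclicDist k i = j + 1 := by
        unfold cyclicMix at hi
        split_ifs at hi <;> omega
      have : cyclicMix x y k (j + 1) =
          Function.update (cyclicMix x y k j) i (cyclicMix x y k (j + 1) i) := by
        funext i'
        by_cases hi' : i' = i
        · subst hi'; simp
        · have : cyclicDist k i' ≠ j + 1 := fun e =>
            hi' (cyclicDist_injective k (e.trans hij.symm))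
          rw [Function.update_of_ne hi']
          unfold cyclicMix
          split_ifs <;> omega
      rw [adj_iff, this]
      exact hammingDist_update_self _ _ (Ne.symm hi)

/-- At its own starting position each mix carries the digit of `y`, so the other arc must have
reached that position as well. The arcs from `k` to `k'` and from `k'` to `k` cover the whole cycle.
-/
theorem cyclicMix_eq_of_ne {x y : Fin l → Fin 3} {k k' : Fin l} {j j' : ℕ} (hkk' : k ≠ k')
    (hk : y k ≠ x k) (hk' : y k' ≠ x k') (h : cyclicMix x y k j = cyclicMix x y k' j') :
    cyclicMix x y k j = y := by
  have h1 : cyclicDist k k' ≤ j := by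
    by_contra hc
    have := congrFun h k'
    simp [cyclicMix, hc, cyclicDist_self] at this
    exact hk' this.symm
  have h2 : cyclicDist k' k ≤ j' := by
    by_contra hc
    have := congrFun h k
    simp [cyclicMix, hc, cyclicDist_self] at this
    exact hk this
  funext i
  rcases cyclicDist_le_or hkk' i with hi | hi
  · simp [cyclicMix, hi.trans h1]
  · rw [h]; simp [cyclicMix, hi.trans h2]

/-- The region of the `p`-th path of a system of disjoint paths from `x` to `y`. -/
def fanRegion (x y : Fin l → Fin 3) (p : Fin l × Bool) : Set (Fin l → Fin 3) :=
  if neighbor x p p.1 = y p.1 then Set.range (cyclicMix x y p.1)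
  else insert y {w | w p.1 = neighbor x p p.1 ∧ ∀ i, i ≠ p.1 → w i = x i ∨ w i = y i}

/-- If the neighbour has the correct digit at `k = p.1`, the path corrects the other positions in
cyclic order from `k`; two such paths meet only at `y`. Otherwise its digit at `k` differs from
those of `x` and `y` and marks the path until it is corrected last. -/
theorem isFan (x y : Fin l → Fin 3) :
    IsFan (ternaryCube l) l x y (fanRegion x y) (neighbor x) where
  injective := neighbor_injective x
  adj := adj_neighbor x
  start p hp := by
    have hne := neighbor_apply_self_ne x p
    unfold fanRegion at hp
    split_ifs at hp with h
    · obtain ⟨j, hj⟩ := hp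
      have := congrFun hj p.1
      simp only [cyclicMix, cyclicDist_self, zero_le, if_true] at this
      exact (hne (h.trans this)).elim
    · rcases hp with hp | hp
      · exact hp
      · exact (hne hp.1.symm).elim
  disjoint p p' hpp' w hw hw' := by
    have hne := neighbor_apply_self_ne x p
    have hne' := neighbor_apply_self_ne x p'
    have hmix : ∀ k j i, cyclicMix x y k j i = x i ∨ cyclicMix x y k j i = y i := by
      intro k j i
      unfold cyclicMix
      split_ifs <;> simp
    have hval : p.1 = p'.1 → neighbor x p p.1 ≠ neighbor x p' p'.1 := by
      intro h1 h2
      apply hpp'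
      apply neighbor_injective x
      funext i
      by_cases hi : i = p.1
      · rw [hi, h2, h1]
      · rw [neighbor_apply_of_ne x p hi, neighbor_apply_of_ne x p' (h1 ▸ hi)]
    unfold fanRegion at hw hw'
    split_ifs at hw hw' with h h' h'
    · obtain ⟨j, rfl⟩ := hw
      obtain ⟨j', hj'⟩ := hw'
      refine cyclicMix_eq_of_ne (fun e => hval e ?_) (h ▸ hne) (h' ▸ hne') hj'.symm
      rw [h, h', e]
    · rcases hw' with hw' | hw'
      · exact hw'
      · obtain ⟨j, rfl⟩ := hw
        grind
    · rcases hw with hw | hw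
      · exact hw
      · obtain ⟨j, rfl⟩ := hw'
        grind
    · rcases hw with hw | hw
      · exact hw
      rcases hw' with hw' | hw'
      · exact hw'
      by_cases e : p.1 = p'.1
      · exact (hval e (by rw [← hw.1, ← hw'.1, e])).elim
      · have h1 := hw'.2 p.1 e
        grind
  reach p := by
    have hne := neighbor_apply_self_ne x p
    have hpos : 1 ≤ l := by have := p.1.isLt; omega
    unfold fanRegion
    split_ifs with h
    · have := reachIn_cyclicMix x y p.1 (l - 1)
      rw [cyclicMix_of_le x y p.1 (by omega), ← h] at this
      have e : Function.update x p.1 (neighbor x p p.1) = neighbor x p := by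
        simp [neighbor]
      rw [e] at this
      exact this.mono_length (by omega)
    · set y' := Function.update y p.1 (neighbor x p p.1) with hy'
      have hy1 : y' p.1 = neighbor x p p.1 := by simp [y']
      have hd : hammingDist y y' = 1 := hammingDist_update_self y p.1 h
      -- The strings agree at `p.1`, which leaves one of the `l` steps for the final correction.
      have hlt : hammingDist (neighbor x p) y' < l := by
        rw [hammingDist]
        refine (Finset.card_lt_card (Finset.filter_ssubset.2 ⟨p.1, Finset.mem_univ _, ?_⟩)).trans_eq
          (by simp)
        simp [hy1]
      refine ((((reachIn_box (neighbor x p) y').mono ?_ le_rfl).trans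
        (.of_adj (q := y) ?_ ?_ ?_)).mono_length (n := l) ?_)
      · rintro w ⟨hw, -⟩
        refine .inr ⟨?_, fun i hi => ?_⟩
        · have := hw p.1; rwa [hy1, or_self] at this
        · simpa [neighbor_apply_of_ne x p hi, y', hi] using hw i
      · rw [adj_iff, hammingDist_comm]; exact hd
      · exact .inr ⟨hy1, fun i hi => .inr (by simp [y', hi])⟩
      · exact .inl rfl
      · omega

end ternaryCube

/-! ### Both last digits 0: labelled paths, and distant `c`, `c'`. -/

namespace E3C

open ternaryCube

variable {r s t : ℕ} {T : Set (E3CVertex r s t)} {n : ℕ}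

theorem adj_digit (a : Fin r → Fin 3) (b : Fin s → Fin 3) (c : Fin t → Fin 3) {d d' : Fin 3}
    (h : d ≠ d') : (E3C r s t).Adj ⟨a, b, c, d⟩ ⟨a, b, c, d'⟩ :=
  .inl ⟨rfl, rfl, rfl, h⟩

theorem adj_zero (a : Fin r → Fin 3) (b : Fin s → Fin 3) {c c' : Fin t → Fin 3}
    (h : (ternaryCube t).Adj c c') : (E3C r s t).Adj ⟨a, b, c, 0⟩ ⟨a, b, c', 0⟩ :=
  .inr (.inl ⟨rfl, rfl, h, rfl, rfl⟩)

theorem adj_one (a : Fin r → Fin 3) {b b' : Fin s → Fin 3} (c : Fin t → Fin 3)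
    (h : (ternaryCube s).Adj b b') : (E3C r s t).Adj ⟨a, b, c, 1⟩ ⟨a, b', c, 1⟩ :=
  .inr (.inr (.inl ⟨rfl, h, rfl, rfl, rfl⟩))

theorem adj_two {a a' : Fin r → Fin 3} (b : Fin s → Fin 3) (c : Fin t → Fin 3)
    (h : (ternaryCube r).Adj a a') : (E3C r s t).Adj ⟨a, b, c, 2⟩ ⟨a', b, c, 2⟩ :=
  .inr (.inr (.inr ⟨h, rfl, rfl, rfl, rfl⟩))

theorem reachIn_digit {a : Fin r → Fin 3} {b : Fin s → Fin 3} {c : Fin t → Fin 3} {d d' : Fin 3}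
    (h : d ≠ d') (hd : ⟨a, b, c, d⟩ ∈ T) (hd' : ⟨a, b, c, d'⟩ ∈ T) :
    ReachIn (E3C r s t) T 1 ⟨a, b, c, d⟩ ⟨a, b, c, d'⟩ :=
  .of_adj (adj_digit a b c h) hd hd'

theorem reachIn_zero {a : Fin r → Fin 3} {b : Fin s → Fin 3} {c c' : Fin t → Fin 3}
    {S : Set (Fin t → Fin 3)} (h : ReachIn (ternaryCube t) S n c c')
    (hT : ∀ w ∈ S, ⟨a, b, w, 0⟩ ∈ T) :
    ReachIn (E3C r s t) T n ⟨a, b, c, 0⟩ ⟨a, b, c', 0⟩ :=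
  h.map (⟨fun w => ⟨a, b, w, 0⟩, fun h => adj_zero a b h⟩ : ternaryCube t →g E3C r s t) hT

theorem reachIn_one {a : Fin r → Fin 3} {b b' : Fin s → Fin 3} {c : Fin t → Fin 3}
    {S : Set (Fin s → Fin 3)} (h : ReachIn (ternaryCube s) S n b b')
    (hT : ∀ w ∈ S, ⟨a, w, c, 1⟩ ∈ T) :
    ReachIn (E3C r s t) T n ⟨a, b, c, 1⟩ ⟨a, b', c, 1⟩ :=
  h.map (⟨fun w => ⟨a, w, c, 1⟩, fun h => adj_one a c h⟩ : ternaryCube s →g E3C r s t) hT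

theorem reachIn_two {a a' : Fin r → Fin 3} {b : Fin s → Fin 3} {c : Fin t → Fin 3}
    {S : Set (Fin r → Fin 3)} (h : ReachIn (ternaryCube r) S n a a')
    (hT : ∀ w ∈ S, ⟨w, b, c, 2⟩ ∈ T) :
    ReachIn (E3C r s t) T n ⟨a, b, c, 2⟩ ⟨a', b, c, 2⟩ :=
  h.map (⟨fun w => ⟨w, b, c, 2⟩, fun h => adj_two b c h⟩ : ternaryCube r →g E3C r s t) hT

/-- There is a fan of `2 * m + 2` paths of length at most `r + s + t + 6` from `u` to `v`. -/
def HasFan (m : ℕ) (u v : E3CVertex r s t) : Prop :=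
  ∃ (T : Option (Option (Fin m × Bool)) → Set (E3CVertex r s t))
    (f : Option (Option (Fin m × Bool)) → E3CVertex r s t),
    IsFan (E3C r s t) (r + s + t + 5) u v T f

/-- The injection of the indices of `2 * m` neighbours into those of all neighbours. -/
def castIndex {m l : ℕ} (h : m ≤ l) (p : Fin m × Bool) : Fin l × Bool := (p.1.castLE h, p.2)

theorem castIndex_injective {m l : ℕ} (h : m ≤ l) : Function.Injective (castIndex h) := by
  rintro ⟨i, e⟩ ⟨j, e'⟩ hij
  simpa [castIndex] using hij

variable {a a' : Fin r → Fin 3} {b b' : Fin s → Fin 3} {c c' : Fin t → Fin 3} {ι : Type*}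
  {R : ι → Set (Fin t → Fin 3)} {g : ι → Fin t → Fin 3}

/-- A fan from `c` to `c'` yields paths that change first a single digit of `c`, then `b`, then
`a`, and then the remaining digits of `c`. -/
theorem isFan_one_two (h : IsFan (ternaryCube t) t c c' R g) (hb : b ≠ b') :
    IsFan (E3C r s t) (r + s + t + 5) ⟨a, b, c, 0⟩ ⟨a', b', c', 0⟩
      (fun i => {w | (w.a = a ∧ w.b = b ∧ w.c = g i ∧ w.d = 0) ∨ (w.a = a ∧ w.c = g i ∧ w.d = 1) ∨
        (w.b = b' ∧ w.c = g i ∧ w.d = 2) ∨ (w.a = a' ∧ w.b = b' ∧ w.c ∈ R i ∧ w.d = 0)})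
      (fun i => ⟨a, b, g i, 0⟩) where
  injective i j hij := h.injective (congrArg E3CVertex.c hij)
  adj i := adj_zero a b (h.adj i)
  start i hi := by
    have := (h.adj i).ne
    simp only [Set.mem_ofPred_eq] at hi
    grind -funext
  -- Until the last stage the block C equals the label `g i`. In the last stage `b ≠ b'` separates a
  -- region from the first vertices of the others, and the sets `R i` do the rest.
  disjoint i j hij w hi hj := by
    have h1 := h.injective.ne hij
    have h2 := h.disjoint i j hij w.c
    simp only [Set.mem_ofPred_eq, E3CVertex.ext_iff] at hi hj ⊢
    grind -funext
  reach i := by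
    have hb := hammingDist_le b b'
    have ha := hammingDist_le a a'
    have hg := h.mem i
    refine (((((reachIn_digit (d' := 1) ?_ ?_ ?_).trans (reachIn_one (reachIn_univ b b') ?_)).trans
      (reachIn_digit (d' := 2) ?_ ?_ ?_)).trans (reachIn_two (reachIn_univ a a') ?_)).trans
      ((reachIn_digit (d' := 0) ?_ ?_ ?_).trans (reachIn_zero (h.reach i) ?_))).mono_length ?_
    all_goals grind -funext

/-- A fan from `c` to `c'` yields paths that change first a single digit of `c`, then `b`, and then
the remaining digits of `c`. -/
theorem isFan_one (h : IsFan (ternaryCube t) t c c' R g) (hb : b ≠ b') :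
    IsFan (E3C r s t) (r + s + t + 5) ⟨a, b, c, 0⟩ ⟨a, b', c', 0⟩
      (fun i => {w | w.a = a ∧ ((w.b = b ∧ w.c = g i ∧ w.d = 0) ∨ (w.c = g i ∧ w.d = 1) ∨
        (w.b = b' ∧ w.c ∈ R i ∧ w.d = 0))})
      (fun i => ⟨a, b, g i, 0⟩) where
  injective i j hij := h.injective (congrArg E3CVertex.c hij)
  adj i := adj_zero a b (h.adj i)
  start i hi := by
    have := (h.adj i).ne
    simp only [Set.mem_ofPred_eq] at hi
    grind -funext
  disjoint i j hij w hi hj := by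
    have h1 := h.injective.ne hij
    have h2 := h.disjoint i j hij w.c
    simp only [Set.mem_ofPred_eq, E3CVertex.ext_iff] at hi hj ⊢
    grind -funext
  reach i := by
    have hb := hammingDist_le b b'
    have hg := h.mem i
    refine (((reachIn_digit (d' := 1) ?_ ?_ ?_).trans (reachIn_one (reachIn_univ b b') ?_)).trans
      ((reachIn_digit (d' := 0) ?_ ?_ ?_).trans (reachIn_zero (h.reach i) ?_))).mono_length ?_
    all_goals grind -funext

/-- A fan from `c` to `c'` inside a single copy of the ternary cube. -/
theorem isFan_zero (h : IsFan (ternaryCube t) t c c' R g) :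
    IsFan (E3C r s t) (r + s + t + 5) ⟨a, b, c, 0⟩ ⟨a, b, c', 0⟩
      (fun i => {w | w.a = a ∧ w.b = b ∧ w.c ∈ R i ∧ w.d = 0})
      (fun i => ⟨a, b, g i, 0⟩) where
  injective i j hij := h.injective (congrArg E3CVertex.c hij)
  adj i := adj_zero a b (h.adj i)
  start i hi := by
    rw [h.start i hi.2.2.1]
  disjoint i j hij w hi hj :=
    E3CVertex.ext hi.1 hi.2.1 (h.disjoint i j hij w.c hi.2.2.1 hj.2.2.1) hi.2.2.2
  reach i := (reachIn_zero (h.reach i) (by simp)).mono_length (by omega)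

/-- Two further paths, through the neighbours of `u` with last digits `1` and `2`, complete a fan
whose other paths start with a change of the block `C`. -/
theorem HasFan.of_isFan {m : ℕ} {u v : E3CVertex r s t} {T : Fin m × Bool → Set (E3CVertex r s t)}
    {f : Fin m × Bool → E3CVertex r s t} (h : IsFan (E3C r s t) (r + s + t + 5) u v T f)
    (hu : u.d = 0) (hf : ∀ i, (f i).d = 0) {S₁ S₂ : Set (E3CVertex r s t)}
    (hu₁ : u ∉ S₁) (hu₂ : u ∉ S₂) (hd : ∀ w ∈ S₁, w ∈ S₂ → w = v)
    (hd₁ : ∀ i, ∀ w ∈ S₁, w ∈ T i → w = v) (hd₂ : ∀ i, ∀ w ∈ S₂, w ∈ T i → w = v)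
    (hr₁ : ReachIn (E3C r s t) S₁ (r + s + t + 5) ⟨u.a, u.b, u.c, 1⟩ v)
    (hr₂ : ReachIn (E3C r s t) S₂ (r + s + t + 5) ⟨u.a, u.b, u.c, 2⟩ v) : HasFan m u v := by
  have hadj : ∀ d, d ≠ 0 → (E3C r s t).Adj u ⟨u.a, u.b, u.c, d⟩ := fun d hd =>
    .inl ⟨rfl, rfl, rfl, by rw [hu]; exact hd.symm⟩
  refine ⟨_, _, (h.option (S := S₁) (p := ⟨u.a, u.b, u.c, 1⟩) ?_ (hadj 1 (by decide))
    (fun h => (hu₁ h).elim) hd₁ hr₁).option (S := S₂) (p := ⟨u.a, u.b, u.c, 2⟩) ?_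
    (hadj 2 (by decide)) (fun h => (hu₂ h).elim) ?_ hr₂⟩
  · intro i hi
    simpa [hf] using congrArg E3CVertex.d hi
  · rintro (_ | i) hi
    · simpa using congrArg E3CVertex.d hi
    · simpa [hf] using congrArg E3CVertex.d hi
  · rintro (_ | i) w hw hw'
    · exact hd w hw' hw
    · exact hd₂ i w hw hw'

variable {m : ℕ}

/-- No neighbour of `c` is `c'`, so the extra paths may use the digits 1 and 2 above `c'` as well as
above `c`. They pass from `c` to `c'` above `(z, b')` and `(z, b)`, where no labelled path has last
digit 0. The detour bound `r + 1` and four changes of the last digit account for the constant 5. -/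
theorem hasFan_zero_of_ne_of_two_le (hr : 1 ≤ r) (hmt : m ≤ t) (hb : b ≠ b')
    (hc : 2 ≤ hammingDist c c') :
    HasFan m (⟨a, b, c, 0⟩ : E3CVertex r s t) ⟨a', b', c', 0⟩ := by
  have h := (isFan c c').comp (castIndex_injective hmt)
  obtain ⟨z, hz, hz', hzd⟩ := exists_third hr a a'
  have hcc : c ≠ c' := by rintro rfl; simp at hc
  have hg : ∀ i, (neighbor c ∘ castIndex hmt) i ≠ c' := by
    intro i e
    have := adj_iff.1 (h.adj i)
    rw [e] at this
    omega
  have hg' : ∀ i, (neighbor c ∘ castIndex hmt) i ≠ c := fun i => (h.adj i).ne'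
  have hbl := hammingDist_le b b'
  have hcl := hammingDist_le c c'
  refine .of_isFan (isFan_one_two h hb) rfl (fun _ => rfl)
    (S₁ := {w | (w.a = a ∧ w.c = c ∧ w.d = 1) ∨ (w.b = b' ∧ w.c = c ∧ w.d = 2) ∨
      (w.a = z ∧ w.b = b' ∧ w.d = 0) ∨ (w.b = b' ∧ w.c = c' ∧ w.d = 2) ∨
      w = ⟨a', b', c', 0⟩})
    (S₂ := {w | (w.b = b ∧ w.c = c ∧ w.d = 2) ∨ (w.a = z ∧ w.b = b ∧ w.d = 0) ∨
      (w.b = b ∧ w.c = c' ∧ w.d = 2) ∨ (w.a = a' ∧ w.c = c' ∧ w.d = 1) ∨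
      w = ⟨a', b', c', 0⟩})
    ?_ ?_ ?_ ?_ ?_ ?_ ?_
  · grind -funext
  · grind -funext
  · intro w h1 h2
    simp only [Set.mem_ofPred_eq] at h1 h2
    grind -funext
  · intro i w h1 h2
    have h3 := hg i
    have h4 := hg' i
    simp only [Set.mem_ofPred_eq] at h1 h2
    grind -funext
  · intro i w h1 h2
    have h3 := hg i
    have h4 := hg' i
    simp only [Set.mem_ofPred_eq] at h1 h2
    grind -funext
  · refine (((((reachIn_one (reachIn_univ b b') ?_).trans (reachIn_digit (d' := 2) ?_ ?_ ?_)).trans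
      (reachIn_two (reachIn_univ a z) ?_)).trans ((reachIn_digit (d' := 0) ?_ ?_ ?_).trans
      (reachIn_zero (reachIn_univ c c') ?_))).trans ((reachIn_digit (d' := 2) ?_ ?_ ?_).trans
      ((reachIn_two (reachIn_univ z a') ?_).trans (reachIn_digit (d' := 0) ?_ ?_ ?_)))).mono_length ?_
    all_goals grind -funext
  · refine ((((reachIn_two (reachIn_univ a z) ?_).trans (reachIn_digit (d' := 0) ?_ ?_ ?_)).trans
      (reachIn_zero (reachIn_univ c c') ?_)).trans (((reachIn_digit (d' := 2) ?_ ?_ ?_).trans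
      (reachIn_two (reachIn_univ z a') ?_)).trans ((reachIn_digit (d' := 1) ?_ ?_ ?_).trans
      ((reachIn_one (reachIn_univ b b') ?_).trans (reachIn_digit (d' := 0) ?_ ?_ ?_))))).mono_length ?_
    all_goals grind -funext

end E3C

/-! ### Labels from balls of radius one. -/

namespace ternaryCube

variable {l : ℕ}

theorem reachIn_pair {x y : Fin l → Fin 3} (h : hammingDist x y ≤ 1) :
    ReachIn (ternaryCube l) {w | w = x ∨ w = y} 1 x y := by
  rcases Nat.le_one_iff_eq_zero_or_eq_one.1 h with h | h
  · obtain rfl := hammingDist_eq_zero.1 h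
    exact (ReachIn.refl (by simp)).mono_length zero_le_one
  · exact .of_adj h (by simp) (by simp)

/-- The first vertex `p` of a geodesic from `x` to `y`, and a set `S` containing the rest of the
geodesic and no other vertex of the closed ball of radius one about `x`. -/
theorem exists_first_step (x y : Fin l → Fin 3) :
    ∃ (p : Fin l → Fin 3) (S : Set (Fin l → Fin 3)), hammingDist x p ≤ 1 ∧ (p = x → x = y) ∧
      (∀ w ∈ S, hammingDist x w ≤ 1 → w = p) ∧ ReachIn (ternaryCube l) S l p y := by
  rcases eq_or_ne x y with rfl | h
  · exact ⟨x, {x}, by simp, fun _ => rfl, by simp, (ReachIn.refl (Set.mem_singleton x)).mono_length l.zero_le⟩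
  · obtain ⟨k, hk⟩ := Function.ne_iff.1 h
    have h1 := hammingDist_update_self x k hk.symm
    have h2 := hammingDist_update_add_one hk
    refine ⟨Function.update x k (y k), _, h1.le, fun e => ?_, ?_,
      (reachIn_box _ y).mono_length (hammingDist_le _ _)⟩
    · rw [e] at h1; simp at h1
    · rintro w ⟨-, hw⟩ hxw
      have h3 := hammingDist_triangle x w y
      -- A vertex within distance one of `x` is at least as far from `y` as the first step is; on
      -- the geodesic this forces equality with the first step.
      exact (hammingDist_eq_zero.1 (by omega)).symm

/-- The closed ball of radius one about `x` contains `2 * m + 1` strings for each `m ≤ l`, one of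
which can be prescribed. -/
theorem exists_enumeration {m : ℕ} (hm : m ≤ l) {x p : Fin l → Fin 3} (hp : hammingDist x p ≤ 1) :
    ∃ A : Option (Fin m × Bool) → Fin l → Fin 3, Function.Injective A ∧
      (∀ i, hammingDist x (A i) ≤ 1) ∧ A none = p := by
  let N : Option (Fin l × Bool) → Fin l → Fin 3 := fun o => o.elim x (neighbor x)
  have hN : Function.Injective N := by
    rintro (_ | i) (_ | j) h
    · rfl
    · exact (neighbor_ne x j h.symm).elim
    · exact (neighbor_ne x i h).elim
    · exact congrArg some (neighbor_injective x h)
  have hball : ∀ o, hammingDist x (N o) ≤ 1 := by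
    rintro (_ | i)
    · simp [N]
    · exact (adj_iff.1 (adj_neighbor x i)).le
  obtain ⟨o, ho⟩ : ∃ o, N o = p := by
    rcases Nat.le_one_iff_eq_zero_or_eq_one.1 hp with h | h
    · exact ⟨none, hammingDist_eq_zero.1 h⟩
    · obtain ⟨q, rfl⟩ := exists_eq_neighbor h
      exact ⟨some q, rfl⟩
  have hinj : Function.Injective fun q : Fin m × Bool => (q.1.castLE hm, q.2) := by
    rintro ⟨i, e⟩ ⟨j, e'⟩ hij
    simpa using hij
  -- The transposition puts the prescribed string at the index `none`.
  exact ⟨fun i => N (Equiv.swap none o (i.map fun q => (q.1.castLE hm, q.2))),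
    hN.comp ((Equiv.injective _).comp (Option.map_injective hinj)), fun i => hball _, by simp [ho]⟩

/-- Strings near `x` can be paired with strings near `y` avoiding two given pairs. -/
theorem exists_pairing {k m : ℕ} (hm : 1 ≤ m) (hml : m ≤ l) (hmk : m ≤ k)
    (x x' : Fin l → Fin 3) (y y' : Fin k → Fin 3) :
    ∃ (A : Option (Fin m × Bool) → Fin l → Fin 3) (B : Option (Fin m × Bool) → Fin k → Fin 3),
      Function.Injective A ∧ Function.Injective B ∧ (∀ i, hammingDist x (A i) ≤ 1) ∧
      (∀ i, hammingDist y' (B i) ≤ 1) ∧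
      ∀ i, ¬ (A i = x ∧ B i = y) ∧ ¬ (A i = x' ∧ B i = y') := by
  obtain ⟨A, hA, hAx, hA0⟩ := exists_enumeration hml (x := x) (p := x) (by simp)
  obtain ⟨B, hB, hBy, hB0⟩ := exists_enumeration hmk (x := y') (p := y') (by simp)
  have key : ∀ {j : ℕ} {C : Option (Fin m × Bool) → Fin j → Fin 3}, Function.Injective C →
      ∀ z, ∃ i, i ≠ none ∧ C i ≠ z := by
    intro j C hC z
    by_contra! hcon
    have h1 := hcon (some (⟨0, hm⟩, true)) (by simp)
    have h2 := hcon (some (⟨0, hm⟩, false)) (by simp)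
    simpa using hC (h1.trans h2.symm)
  obtain ⟨i₁, hi₁, hAi⟩ := key hA x'
  obtain ⟨i₂, hi₂, hBi⟩ := key hB y
  -- The index with `A = x` receives `B i₂ ≠ y`, and `y'` goes to `i₁`, where `A i₁ ≠ x'`; both
  -- forbidden pairs are avoided.
  let σ := Equiv.swap none i₂ * Equiv.swap i₁ i₂
  have hσ : σ none = i₂ := by
    simp [σ, Equiv.swap_apply_of_ne_of_ne hi₁.symm hi₂.symm]
  have hσ' : σ i₁ = none := by simp [σ]
  refine ⟨A, B ∘ σ, hA, hB.comp σ.injective, hAx, fun i => hBy _, fun i => ⟨?_, ?_⟩⟩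
  · rintro ⟨h1, h2⟩
    obtain rfl := hA (h1.trans hA0.symm)
    rw [Function.comp_apply, hσ] at h2
    exact hBi h2
  · rintro ⟨h1, h2⟩
    obtain rfl := σ.injective ((hB (h2.trans hB0.symm)).trans hσ'.symm)
    exact hAi h1

end ternaryCube

/-! ### Both last digits 0: the remaining cases. -/

namespace E3C

open ternaryCube

variable {r s t m : ℕ} {a a' : Fin r → Fin 3} {b b' : Fin s → Fin 3} {c c' : Fin t → Fin 3}

/-- A label may now be `c'`. At digit 1 above `c'` the second extra path has `A = a'`, whereas
labelled paths have `A = a` there. The first enters the copy above `(a', b')` at `c` and is at most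
one step from `v`; no fan region contains `c` unless `c = c'`. -/
theorem hasFan_zero_of_ne_of_ne_of_le_one (hmt : m ≤ t) (ha : a ≠ a') (hb : b ≠ b')
    (hc : hammingDist c c' ≤ 1) :
    HasFan m (⟨a, b, c, 0⟩ : E3CVertex r s t) ⟨a', b', c', 0⟩ := by
  have h := (isFan c c').comp (castIndex_injective hmt)
  have hal := hammingDist_le a a'
  have hbl := hammingDist_le b b'
  have hcl := hammingDist_le c c'
  refine .of_isFan (isFan_one_two h hb) rfl (fun _ => rfl)
    (S₁ := {w | (w.a = a ∧ w.c = c ∧ w.d = 1) ∨ (w.b = b' ∧ w.c = c ∧ w.d = 2) ∨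
      (w.a = a' ∧ w.b = b' ∧ w.c = c ∧ w.d = 0) ∨ w = ⟨a', b', c', 0⟩})
    (S₂ := {w | (w.b = b ∧ w.c = c ∧ w.d = 2) ∨ (w.a = a' ∧ w.b = b ∧ w.d = 0) ∨
      (w.a = a' ∧ w.c = c' ∧ w.d = 1) ∨ w = ⟨a', b', c', 0⟩})
    ?_ ?_ ?_ ?_ ?_ ?_ ?_
  · grind -funext
  · grind -funext
  · intro w h1 h2
    simp only [Set.mem_ofPred_eq] at h1 h2
    grind -funext
  · intro i w h1 h2
    have h3 := (h.adj i).ne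
    have h4 := h.start i
    simp only [Set.mem_ofPred_eq, E3CVertex.ext_iff] at h1 h2 ⊢
    grind -funext
  · intro i w h1 h2
    have h3 := (h.adj i).ne
    have h4 := h.start i
    simp only [Set.mem_ofPred_eq] at h1 h2
    grind -funext
  · refine ((((reachIn_one (reachIn_univ b b') ?_).trans (reachIn_digit (d' := 2) ?_ ?_ ?_)).trans
      (reachIn_two (reachIn_univ a a') ?_)).trans ((reachIn_digit (d' := 0) ?_ ?_ ?_).trans
      (reachIn_zero (reachIn_pair hc) ?_))).mono_length ?_
    all_goals grind -funext
  · refine ((((reachIn_two (reachIn_univ a a') ?_).trans (reachIn_digit (d' := 0) ?_ ?_ ?_)).trans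
      (reachIn_zero (reachIn_univ c c') ?_)).trans ((reachIn_digit (d' := 1) ?_ ?_ ?_).trans
      ((reachIn_one (reachIn_univ b b') ?_).trans (reachIn_digit (d' := 0) ?_ ?_ ?_)))).mono_length ?_
    all_goals grind -funext

/-- Since `a` needs no correction, labelled paths skip digit 2. The second extra path can use it
even above `c'`, and has `A = z` at the digits 0 and 1 before reaching `v`. -/
theorem hasFan_zero_of_eq_of_ne_of_le_one (hr : 1 ≤ r) (hmt : m ≤ t) (hb : b ≠ b')
    (hc : hammingDist c c' ≤ 1) :
    HasFan m (⟨a, b, c, 0⟩ : E3CVertex r s t) ⟨a, b', c', 0⟩ := by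
  have h := (isFan c c').comp (castIndex_injective hmt)
  obtain ⟨z, hz, -, hzd⟩ := exists_third hr a a
  have hbl := hammingDist_le b b'
  have hcl := hammingDist_le c c'
  refine .of_isFan (isFan_one h hb) rfl (fun _ => rfl)
    (S₁ := {w | w.a = a ∧ w.c = c ∧ w.d = 1 ∨ w.a = a ∧ w.b = b' ∧ w.c = c ∧ w.d = 0 ∨
      w = ⟨a, b', c', 0⟩})
    (S₂ := {w | (w.b = b ∧ w.c = c ∧ w.d = 2) ∨ (w.a = z ∧ w.c = c ∧ w.d = 1) ∨
      (w.a = z ∧ w.b = b' ∧ w.d = 0) ∨ (w.b = b' ∧ w.c = c' ∧ w.d = 2) ∨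
      w = ⟨a, b', c', 0⟩})
    ?_ ?_ ?_ ?_ ?_ ?_ ?_
  · grind -funext
  · grind -funext
  · intro w h1 h2
    simp only [Set.mem_ofPred_eq] at h1 h2
    grind -funext
  · intro i w h1 h2
    have h3 := (h.adj i).ne
    have h4 := h.start i
    simp only [Set.mem_ofPred_eq, E3CVertex.ext_iff] at h1 h2 ⊢
    grind -funext
  · intro i w h1 h2
    have h3 := (h.adj i).ne
    have h4 := h.start i
    simp only [Set.mem_ofPred_eq] at h1 h2
    grind -funext
  · refine ((reachIn_one (reachIn_univ b b') ?_).trans ((reachIn_digit (d' := 0) ?_ ?_ ?_).trans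
      (reachIn_zero (reachIn_pair hc) ?_))).mono_length ?_
    all_goals grind -funext
  · refine ((((reachIn_two (reachIn_univ a z) ?_).trans (reachIn_digit (d' := 1) ?_ ?_ ?_)).trans
      (reachIn_one (reachIn_univ b b') ?_)).trans (((reachIn_digit (d' := 0) ?_ ?_ ?_).trans
      (reachIn_zero (reachIn_univ c c') ?_)).trans ((reachIn_digit (d' := 2) ?_ ?_ ?_).trans
      ((reachIn_two (reachIn_univ z a) ?_).trans (reachIn_digit (d' := 0) ?_ ?_ ?_))))).mono_length ?_
    all_goals grind -funext

/-- The fan lies in the copy above `(a, b)`; the extra paths cross in the parallel copies above `(a,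
y)` and `(z, b)`. -/
theorem hasFan_zero_of_eq_of_eq (hr : 1 ≤ r) (hs : 1 ≤ s) (hmt : m ≤ t) (hc : c ≠ c') :
    HasFan m (⟨a, b, c, 0⟩ : E3CVertex r s t) ⟨a, b, c', 0⟩ := by
  have h := (isFan c c').comp (castIndex_injective hmt)
  obtain ⟨z, hz, -, hzd⟩ := exists_third hr a a
  obtain ⟨y, hy, -, hyd⟩ := exists_third hs b b
  have hcl := hammingDist_le c c'
  refine .of_isFan (isFan_zero h) rfl (fun _ => rfl)
    (S₁ := {w | (w.a = a ∧ w.c = c ∧ w.d = 1) ∨ (w.a = a ∧ w.b = y ∧ w.d = 0) ∨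
      (w.a = a ∧ w.c = c' ∧ w.d = 1) ∨ w = ⟨a, b, c', 0⟩})
    (S₂ := {w | (w.b = b ∧ w.c = c ∧ w.d = 2) ∨ (w.a = z ∧ w.b = b ∧ w.d = 0) ∨
      (w.b = b ∧ w.c = c' ∧ w.d = 2) ∨ w = ⟨a, b, c', 0⟩})
    ?_ ?_ ?_ ?_ ?_ ?_ ?_
  · grind -funext
  · grind -funext
  · intro w h1 h2
    simp only [Set.mem_ofPred_eq] at h1 h2
    grind -funext
  · intro i w h1 h2
    simp only [Set.mem_ofPred_eq] at h1 h2
    grind -funext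
  · intro i w h1 h2
    simp only [Set.mem_ofPred_eq] at h1 h2
    grind -funext
  · refine ((((reachIn_one (reachIn_univ b y) ?_).trans (reachIn_digit (d' := 0) ?_ ?_ ?_)).trans
      (reachIn_zero (reachIn_univ c c') ?_)).trans ((reachIn_digit (d' := 1) ?_ ?_ ?_).trans
      ((reachIn_one (reachIn_univ y b) ?_).trans (reachIn_digit (d' := 0) ?_ ?_ ?_)))).mono_length ?_
    all_goals grind -funext
  · refine ((((reachIn_two (reachIn_univ a z) ?_).trans (reachIn_digit (d' := 0) ?_ ?_ ?_)).trans
      (reachIn_zero (reachIn_univ c c') ?_)).trans ((reachIn_digit (d' := 2) ?_ ?_ ?_).trans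
      ((reachIn_two (reachIn_univ z a) ?_).trans (reachIn_digit (d' := 0) ?_ ?_ ?_)))).mono_length ?_
    all_goals grind -funext


/-! ### Last digits 0 and 1. -/

variable {r s t m : ℕ} {a a' : Fin r → Fin 3} {b b' : Fin s → Fin 3} {c c' : Fin t → Fin 3}
  {ι : Type*} {A : ι → Fin t → Fin 3} {B : ι → Fin s → Fin 3}

/-- The region of the path from `⟨a, b, c, 0⟩` to `⟨a', b', c', 1⟩` that changes in turn `c` into
`p`, `b` into `q`, `a` into `a'`, `p` into `c'` and `q` into `b'`. -/
def pairRegion (a a' : Fin r → Fin 3) (b b' : Fin s → Fin 3) (c c' p : Fin t → Fin 3)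
    (q : Fin s → Fin 3) : Set (E3CVertex r s t) :=
  -- The clause `p ≠ c` keeps `u` out of the region: with label `c` the path goes to digit 1 at
  -- once.
  {w | (w.a = a ∧ w.b = b ∧ w.c = p ∧ w.d = 0 ∧ p ≠ c) ∨ (w.a = a ∧ w.c = p ∧ w.d = 1) ∨
    (w.b = q ∧ w.c = p ∧ w.d = 2) ∨ (w.a = a' ∧ w.b = q ∧ w.d = 0) ∨
    (w.a = a' ∧ w.b = q ∧ w.c = c' ∧ w.d = 1) ∨ w = ⟨a', b', c', 1⟩}

theorem adj_first {p : Fin t → Fin 3} (hp : hammingDist c p ≤ 1) :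
    (E3C r s t).Adj ⟨a, b, c, 0⟩ ⟨a, b, p, if p = c then 1 else 0⟩ := by
  split_ifs with h
  · subst h; exact adj_digit a b p (by decide)
  · refine adj_zero a b (adj_iff.2 (le_antisymm hp ?_))
    exact Nat.one_le_iff_ne_zero.2 fun h0 => h (hammingDist_eq_zero.1 h0).symm

/-- Equal stages of two paths are separated by their labels. Different stages can clash only at
digit 0, between `(a, b, A i)` and `(a', B j, _)`, or at digit 1, between `(a, _, A i)` and `(a', B
j, c')`; the alternative `ha` excludes both. -/
theorem isFan_pairs (hA : Function.Injective A) (hB : Function.Injective B)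
    (hAc : ∀ i, hammingDist c (A i) ≤ 1) (hBb : ∀ i, hammingDist b' (B i) ≤ 1)
    (ha : a ≠ a' ∨ ∀ i, A i ≠ c' ∧ B i ≠ b) :
    IsFan (E3C r s t) (r + s + t + 5) ⟨a, b, c, 0⟩ ⟨a', b', c', 1⟩
      (fun i => pairRegion a a' b b' c c' (A i) (B i))
      (fun i => ⟨a, b, A i, if A i = c then 1 else 0⟩) where
  injective i j hij := hA (congrArg E3CVertex.c hij)
  adj i := adj_first (hAc i)
  start i hi := by
    simp only [pairRegion, Set.mem_ofPred_eq] at hi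
    grind -funext
  disjoint i j hij w hi hj := by
    have h1 := hA.ne hij
    have h2 := hB.ne hij
    simp only [pairRegion, Set.mem_ofPred_eq] at hi hj
    grind -funext
  reach i := by
    have h1 := hammingDist_le a a'
    have h2 := hammingDist_le b (B i)
    have h3 := hammingDist_le (A i) c'
    have h4 : ReachIn (E3C r s t) (pairRegion a a' b b' c c' (A i) (B i)) 1
        ⟨a, b, A i, if A i = c then 1 else 0⟩ ⟨a, b, A i, 1⟩ := by
      split_ifs with h
      · exact (ReachIn.refl (by simp [pairRegion])).mono_length zero_le_one
      · exact reachIn_digit (by decide) (by simp [pairRegion, h]) (by simp [pairRegion])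
    -- Besides `s + r + t`, there is at most one initial step, three changes of the last digit, and
    -- at most one step from `B i` to `b'`: the bound is used in full.
    refine ((((h4.trans (reachIn_one (reachIn_univ b (B i)) ?_)).trans
      (reachIn_digit (d' := 2) ?_ ?_ ?_)).trans ((reachIn_two (reachIn_univ a a') ?_).trans
      (reachIn_digit (d' := 0) ?_ ?_ ?_))).trans (((reachIn_zero (reachIn_univ (A i) c') ?_).trans
      (reachIn_digit (d' := 1) ?_ ?_ ?_)).trans
      (reachIn_one (reachIn_pair (hammingDist_comm b' (B i) ▸ hBb i)) ?_))).mono_length ?_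
    all_goals grind -funext [pairRegion]

/-- One further path, through the neighbour of `u` with last digit `2`, completes a fan from a vertex
with last digit `0` to one with last digit `1`. -/
theorem HasFan.of_isFan_option {u v : E3CVertex r s t}
    {T : Option (Fin m × Bool) → Set (E3CVertex r s t)} {f : Option (Fin m × Bool) → E3CVertex r s t}
    (h : IsFan (E3C r s t) (r + s + t + 5) u v T f) (hr : 1 ≤ r)
    (hu : u = ⟨a, b, c, 0⟩) (hv : v = ⟨a', b', c', 1⟩) (hf : ∀ i, (f i).d ≠ 2)
    (hT : ∀ i, ∀ w ∈ T i, w ≠ v → (w.d = 2 → ¬ (w.c = c ∧ w.b = b) ∧ ¬ (w.c = c' ∧ w.b = b')) ∧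
      (w.d ≠ 2 → w.a = a ∨ w.a = a')) :
    HasFan m u v := by
  -- With `A = z` at the digits 0 and 1, the extra path can meet the others before `v` only at digit
  -- 2.
  obtain ⟨z, hz, hz', hzd⟩ := exists_third hr a a'
  have hbl := hammingDist_le b b'
  have hcl := hammingDist_le c c'
  subst hu hv
  refine ⟨_, _, h.option (p := ⟨a, b, c, 2⟩)
    (S := {w | (w.b = b ∧ w.c = c ∧ w.d = 2) ∨ (w.a = z ∧ w.b = b ∧ w.d = 0) ∨
      (w.a = z ∧ w.c = c' ∧ w.d = 1) ∨ (w.b = b' ∧ w.c = c' ∧ w.d = 2) ∨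
      w = ⟨a', b', c', 1⟩}) ?_ (adj_digit a b c (by decide)) ?_ ?_ ?_⟩
  · intro i hi
    exact hf i (congrArg E3CVertex.d hi.symm)
  · grind -funext
  · intro i w h1 h2
    by_contra hw
    have h3 := hT i w h2 hw
    simp only [Set.mem_ofPred_eq] at h1
    grind -funext
  · refine ((((reachIn_two (reachIn_univ a z) ?_).trans (reachIn_digit (d' := 0) ?_ ?_ ?_)).trans
      (reachIn_zero (reachIn_univ c c') ?_)).trans (((reachIn_digit (d' := 1) ?_ ?_ ?_).trans
      (reachIn_one (reachIn_univ b b') ?_)).trans ((reachIn_digit (d' := 2) ?_ ?_ ?_).trans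
      ((reachIn_two (reachIn_univ z a') ?_).trans (reachIn_digit (d' := 1) ?_ ?_ ?_))))).mono_length ?_
    all_goals grind -funext

theorem hasFan_zero_one_of_ne (hr : 1 ≤ r) (hm : 1 ≤ m) (hms : m ≤ s) (hmt : m ≤ t)
    (ha : a ≠ a') : HasFan m (⟨a, b, c, 0⟩ : E3CVertex r s t) ⟨a', b', c', 1⟩ := by
  obtain ⟨A, B, hA, hB, hAc, hBb, hAB⟩ := exists_pairing hm hmt hms c c' b b'
  refine .of_isFan_option (isFan_pairs hA hB hAc hBb (.inl ha)) hr rfl rfl ?_ ?_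
  · intro i
    dsimp only
    split_ifs <;> decide
  · intro i w hw hwv
    have := hAB i
    simp only [pairRegion, Set.mem_ofPred_eq] at hw
    grind -funext

/-- Within the unit balls, the geodesic parts `S` and `S'` contain only their first steps `p` and
`q`. Reserving these for the direct path leaves `2 * m` labels off both parts, hence different from
`c'` and `b`. -/
theorem hasFan_zero_one_of_eq (hr : 1 ≤ r) (hms : m ≤ s) (hmt : m ≤ t) :
    HasFan m (⟨a, b, c, 0⟩ : E3CVertex r s t) ⟨a, b', c', 1⟩ := by
  obtain ⟨p, S, hp, hpc, hS, hpS⟩ := exists_first_step c c'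
  obtain ⟨q, S', hq, hqb, hS', hqS⟩ := exists_first_step b' b
  obtain ⟨A, hA, hAc, hAp⟩ := exists_enumeration hmt hp
  obtain ⟨B, hB, hBb, hBq⟩ := exists_enumeration hms hq
  obtain ⟨w, -, hw⟩ := id hpS
  have hc' : c' ∈ S := hw _ w.end_mem_support
  obtain ⟨w', -, hw'⟩ := id hqS
  have hb : b ∈ S' := hw' _ w'.end_mem_support
  have hqS' : q ∈ S' := hw' _ w'.start_mem_support
  have hAp' : ∀ i, A (some i) ∉ S := fun i hi =>
    absurd (hA ((hS _ hi (hAc _)).trans hAp.symm)) (by simp)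
  have hBq' : ∀ i, B (some i) ∉ S' := fun i hi =>
    absurd (hB ((hS' _ hi (hBb _)).trans hBq.symm)) (by simp)
  have hAc' : ∀ i, A (some i) ≠ c' := fun i h => hAp' i (h ▸ hc')
  have hBb' : ∀ i, B (some i) ≠ b := fun i h => hBq' i (h ▸ hb)
  have hpA : ∀ i, p ≠ A (some i) := fun i h => absurd (hA (hAp.trans h)) (by simp)
  have hinj := Option.some_injective (Fin m × Bool)
  refine .of_isFan_option ((isFan_pairs (hA.comp hinj) (hB.comp hinj) (fun i => hAc _)
    (fun i => hBb _) (.inr fun i => ⟨hAc' i, hBb' i⟩)).option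
    (p := ⟨a, b, p, if p = c then 1 else 0⟩)
    (S := {w | (w.a = a ∧ w.b = b ∧ w.c ∈ S ∧ w.d = 0 ∧ w.c ≠ c) ∨
      (w.a = a ∧ w.b ∈ S' ∧ w.c = c' ∧ w.d = 1) ∨ w = ⟨a, b', c', 1⟩})
    ?_ (adj_first hp) ?_ ?_ ?_) hr rfl rfl ?_ ?_
  · exact fun i hi => hpA i (congrArg E3CVertex.c hi)
  · grind -funext
  · intro i w h1 h2
    have h3 := hAp' i
    have h4 := hBq' i
    have h5 := hAc' i
    have h6 := hBb' i
    simp only [pairRegion, Set.mem_ofPred_eq, Function.comp_apply] at h1 h2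
    grind -funext
  · have h1 : ReachIn (E3C r s t) {w | (w.a = a ∧ w.b = b ∧ w.c ∈ S ∧ w.d = 0 ∧ w.c ≠ c) ∨
        (w.a = a ∧ w.b ∈ S' ∧ w.c = c' ∧ w.d = 1) ∨ w = ⟨a, b', c', 1⟩} (t + 1)
        ⟨a, b, p, if p = c then 1 else 0⟩ ⟨a, b, c', 1⟩ := by
      split_ifs with h
      · obtain rfl := hpc h
        subst h
        exact (ReachIn.refl (.inr (.inl ⟨rfl, hb, rfl, rfl⟩))).mono_length (by omega)
      · have hcS : ∀ x ∈ S, x ≠ c := by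
          rintro x hx rfl
          exact h (hS x hx (by simp)).symm
        refine (reachIn_zero hpS ?_).trans (reachIn_digit (by decide) ?_ ?_)
        all_goals grind -funext
    -- The geodesic was built from `b'` towards `b`, so it is traversed backwards and `q` comes just
    -- before `b'`.
    refine (h1.trans ((reachIn_one hqS.symm ?_).trans
      (reachIn_one (reachIn_pair (hammingDist_comm b' q ▸ hq)) ?_))).mono_length ?_
    all_goals grind -funext
  · rintro (_ | i)
    · dsimp only [Option.elim]
      split_ifs <;> decide
    · dsimp only [Option.elim]
      split_ifs <;> decide
  · rintro (_ | i) w hw hwv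
    · simp only [Option.elim, Set.mem_ofPred_eq] at hw
      grind -funext
    · have h5 := hAc' i
      have h6 := hBb' i
      simp only [Option.elim, pairRegion, Set.mem_ofPred_eq, Function.comp_apply] at hw
      grind -funext

/-! ### Block symmetries and conclusion. -/

/-- Exchanging the blocks `A` and `B`. -/
def swapAB (r s t : ℕ) : E3C r s t ≃g E3C s r t where
  toFun w := ⟨w.b, w.a, w.c, Equiv.swap 1 2 w.d⟩
  invFun w := ⟨w.b, w.a, w.c, Equiv.swap 1 2 w.d⟩
  left_inv w := by simp
  right_inv w := by simp
  map_rel_iff' := by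
    rintro ⟨a, b, c, d⟩ ⟨a', b', c', d'⟩
    simp only [E3C, E3CAdj, Equiv.coe_fn_mk]
    fin_cases d <;> fin_cases d' <;> simp [Equiv.swap_apply_def] <;> tauto

/-- Exchanging the blocks `B` and `C`. -/
def swapBC (r s t : ℕ) : E3C r s t ≃g E3C r t s where
  toFun w := ⟨w.a, w.c, w.b, Equiv.swap 0 1 w.d⟩
  invFun w := ⟨w.a, w.c, w.b, Equiv.swap 0 1 w.d⟩
  left_inv w := by simp
  right_inv w := by simp
  map_rel_iff' := by
    rintro ⟨a, b, c, d⟩ ⟨a', b', c', d'⟩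
    simp only [E3C, E3CAdj, Equiv.coe_fn_mk]
    fin_cases d <;> fin_cases d' <;> simp [Equiv.swap_apply_def] <;> tauto

/-- The length bound is symmetric in the block lengths, so fans transport back. The two exchanges
generate all permutations of the blocks. -/
theorem HasFan.of_swapAB {u v : E3CVertex r s t}
    (h : HasFan m (swapAB r s t u) (swapAB r s t v)) : HasFan m u v := by
  obtain ⟨T, f, h⟩ := h
  have h' := h.map_iso (swapAB r s t).symm
  simp only [RelIso.symm_apply_apply, add_comm s r] at h'
  exact ⟨_, _, h'⟩

theorem HasFan.of_swapBC {u v : E3CVertex r s t}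
    (h : HasFan m (swapBC r s t u) (swapBC r s t v)) : HasFan m u v := by
  obtain ⟨T, f, h⟩ := h
  have h' := h.map_iso (swapBC r s t).symm
  simp only [RelIso.symm_apply_apply, add_right_comm r t s] at h'
  exact ⟨_, _, h'⟩

theorem hasFan_zero_of_ne (hr : 1 ≤ r) (hmt : m ≤ t) (hb : b ≠ b') :
    HasFan m (⟨a, b, c, 0⟩ : E3CVertex r s t) ⟨a', b', c', 0⟩ := by
  rcases le_or_gt 2 (hammingDist c c') with h | h
  · exact hasFan_zero_of_ne_of_two_le hr hmt hb h
  · rcases eq_or_ne a a' with rfl | ha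
    · exact hasFan_zero_of_eq_of_ne_of_le_one hr hmt hb (by omega)
    · exact hasFan_zero_of_ne_of_ne_of_le_one hmt ha hb (by omega)

theorem hasFan_zero (hr : 1 ≤ r) (hs : 1 ≤ s) (hmt : m ≤ t) {u v : E3CVertex r s t}
    (hu : u.d = 0) (hv : v.d = 0) (huv : u ≠ v) : HasFan m u v := by
  obtain ⟨a, b, c, d⟩ := u
  obtain ⟨a', b', c', d'⟩ := v
  subst hu hv
  rcases eq_or_ne b b' with rfl | hb
  · rcases eq_or_ne a a' with rfl | ha
    · exact hasFan_zero_of_eq_of_eq hr hs hmt (by rintro rfl; exact huv rfl)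
    · exact .of_swapAB (hasFan_zero_of_ne hs hmt ha)
  · exact hasFan_zero_of_ne hr hmt hb

theorem hasFan_zero_one (hr : 1 ≤ r) (hm : 1 ≤ m) (hms : m ≤ s) (hmt : m ≤ t)
    {u v : E3CVertex r s t} (hu : u.d = 0) (hv : v.d = 1) : HasFan m u v := by
  obtain ⟨a, b, c, d⟩ := u
  obtain ⟨a', b', c', d'⟩ := v
  subst hu hv
  rcases eq_or_ne a a' with rfl | ha
  · exact hasFan_zero_one_of_eq hr hms hmt
  · exact hasFan_zero_one_of_ne hr hm hms hmt ha

theorem hasFan (hm : 1 ≤ m) (hmr : m ≤ r) (hms : m ≤ s) (hmt : m ≤ t) {u v : E3CVertex r s t}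
    (huv : u ≠ v) : HasFan m u v := by
  have hr := hm.trans hmr
  have hs := hm.trans hms
  have ht := hm.trans hmt
  have hAB : ∀ {r s t} (w : E3CVertex r s t), (swapAB r s t w).d = Equiv.swap 1 2 w.d := fun _ => rfl
  have hBC : ∀ {r s t} (w : E3CVertex r s t), (swapBC r s t w).d = Equiv.swap 0 1 w.d := fun _ => rfl
  have h3 : ∀ d : Fin 3, d = 0 ∨ d = 1 ∨ d = 2 := by decide
  have h01 : (Equiv.swap (1 : Fin 3) 2) 0 = 0 := by decide
  have h02 : (Equiv.swap (0 : Fin 3) 1) 2 = 2 := by decide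
  -- Equal digits are moved to `(0, 0)` and unequal ones to `(0, 1)`; `m` is at most every block
  -- length, so any order of the blocks is allowed.
  rcases h3 u.d with hu | hu | hu <;> rcases h3 v.d with hv | hv | hv
  · exact hasFan_zero hr hs hmt hu hv huv
  · exact hasFan_zero_one hr hm hms hmt hu hv
  · exact .of_swapAB (hasFan_zero_one hs hm hmr hmt (by simp [hAB, hu, h01]) (by simp [hAB, hv]))
  · exact .of_swapBC (hasFan_zero_one hr hm hmt hms (by simp [hBC, hu]) (by simp [hBC, hv]))
  · exact .of_swapBC (hasFan_zero hr ht hms (by simp [hBC, hu]) (by simp [hBC, hv])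
      ((swapBC r s t).injective.ne huv))
  · exact .of_swapBC (.of_swapAB (hasFan_zero_one ht hm hmr hms (by simp [hAB, hBC, hu, h01])
      (by simp [hAB, hBC, hv, h02])))
  · exact .of_swapAB (.of_swapBC (hasFan_zero_one hs hm hmt hmr (by simp [hAB, hBC, hu])
      (by simp [hAB, hBC, hv, h01])))
  · exact .of_swapAB (.of_swapBC (.of_swapAB (hasFan_zero_one ht hm hms hmr
      (by simp [hAB, hBC, hu, h01]) (by simp [hAB, hBC, hv, h02]))))
  · exact .of_swapAB (.of_swapBC (hasFan_zero hs ht hmr (by simp [hAB, hBC, hu])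
      (by simp [hAB, hBC, hv]) ((swapBC s r t).injective.ne ((swapAB r s t).injective.ne huv))))

end E3C

theorem theorem2 (r s t n : ℕ) (hr : 1 ≤ r) (hrs : r ≤ s) (hst : s ≤ t)
    (hn : n = r + s + t + 1) :
    wideDiameter (E3C r s t) (2 * r + 2) ≤ ((r + s + t + 6 : ℕ) : ℕ∞) ∧
    r + s + t + 6 = n + 5 ∧
    ∀ u v : E3CVertex r s t, u ≠ v →
      ∃ P : Fin (2 * r + 2) → (E3C r s t).Path u v,
        IsDisjointPathSystem P ∧ ∀ i, (P i).1.length ≤ n + 5 := by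
  have key : ∀ u v : E3CVertex r s t, u ≠ v →
      ∃ P : Fin (2 * r + 2) → (E3C r s t).Path u v,
        IsDisjointPathSystem P ∧ ∀ i, (P i).1.length ≤ r + s + t + 6 := by
    intro u v huv
    -- The shortest block permits `m = r`; the edge from `u` to the first neighbour turns the
    -- constant 5 into 6.
    obtain ⟨T, f, h⟩ := E3C.hasFan hr le_rfl hrs (hrs.trans hst) huv
    exact h.exists_pathSystem huv (by simp [mul_comm])
  refine ⟨?_, by omega, fun u v huv => ?_⟩
  · refine iSup_le fun u => iSup_le fun v => iSup_le fun huv => ?_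
    obtain ⟨P, hP, hl⟩ := key u v huv
    exact (iInf₂_le P hP).trans (iSup_le fun i => by exact_mod_cast hl i)
  · obtain ⟨P, hP, hl⟩ := key u v huv
    exact ⟨P, hP, fun i => (hl i).trans (by omega)⟩
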